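/- Consider the differential game with a leader (player $0$) and followers $1,\dots,n$, dynamics $$\dot x=f(t,x,u_0,u_1,\dots,u_n),\quad t\in[0,T],\quad x\in\mathbb R^d,\quad x(0)=x_0,\quad u_k\in P_k .$$ Let $\mathcal U_k$ be the set of measurable functions $[0,T]\to P_k$ and $\mathcal U=\mathcal U_1\times\dots\times\mathcal U_n$. Assume that for all $(t_*,x_*)\in[0,T]\times\mathbb R^d$, $u_0\in\mathcal U_0$, $u\in\mathcal U$ there is exactly one (Carathéodory) solution $x(\cdot)=x(\cdot,t_*,x_*,u_0,u)$ on $[t_*,T]$ with $x(t_*)=x_*$, and that the running payoffs $g_k$ are integrable along it. Put $$J_k(t_*,x_*,u_0,u)=\sigma_k(x(T))+\int_{t_*}^T g_k(t,x(t),u_0(t),u(t))\,dt,\qquad k=0,\dots,n,$$ and omit $(t_*,x_*)$ when it is $(0,x_0)$. Every player maximizes his payoff. The followers use open-loop controls $u\in\mathcal U$. The leader uses a nonanticipative strategy, i.e. a map $\alpha:\mathcal U\to\mathcal U_0$ such that $\alpha[u](\tau)=\alpha[u'](\tau)$ whenever $u=u'$ on $[0,\tau]$. Let $\mathcal E_d(\alpha)$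 be the set of $u\in\mathcal U$ with $J_i(\alpha[u],u)\ge J_i(\alpha[u_i',u_{-i}],(u_i',u_{-i}))$ for all $i=1,\dots,n$ and $u_i'\in\mathcal U_i$. The pair $(\alpha^*,u^*)$ is an inverse Stackelberg solution if $u^*\in\mathcal E_d(\alpha^*)$ and $J_0(\alpha^*[u^*],u^*)\ge J_0(\alpha[u],u)$ for all nonanticipative $\alpha$ and all $u\in\mathcal E_d(\alpha)$. For $i=1,\dots,n$ let $$V_i^-(t_*,x_*,u_{-i})=\min_{\alpha}\sup_{u_i'\in\mathcal U_i}J_i\bigl(t_*,x_*,\alpha[u_i',u_{-i}],(u_i',u_{-i})\bigr)$$ be the lower value of the zero-sum game between the leader and follower $i$, with values in $[-\infty,+\infty]$; it is assumed that the minimum over nonanticipative $\alpha$ is attained. Let $\mathcal C$ be the set of $(u_0,u)\in\mathcal U_0\times\mathcal U$ such that, with $x(\cdot)=x(\cdot,0,x_0,u_0,u)$, $$J_i(t,x(t),u_0,u)\ge V_i^-(t,x(t),u_{-i})\quad\text{for all } t\in[0,T],\ i=1,\dots,n .$$ Theorem. 1. If $(\alpha^*,u^*)$ is an inverse Stackelberg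 solution and $u_0^*=\alpha^*[u^*]$, then $(u_0^*,u^*)\in\mathcal C$ and $(u_0^*,u^*)$ maximizes $J_0$ over $\mathcal C$. 2. Conversely, if $(u_0^*,u^*)\in\mathcal C$ maximizes $J_0$ over $\mathcal C$, then there exists a nonanticipative strategy $\alpha^*$ of the leader such that $\alpha^*[u^*]=u_0^*$ and $(\alpha^*,u^*)$ is an inverse Stackelberg solution. -/

import Mathlib

open Set MeasureTheory

noncomputable section

/-- A measurable function on the time interval `[0, T]` with values in `Q`. -/
def OpenLoop (T : ℝ) (Q : Type*) [MeasurableSpace Q] : Type _ :=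
  {u : Icc (0 : ℝ) T → Q // Measurable u}

/-- A differential game of one leader (player `0`) and `n` followers (players `1, …, n`, written
`i.succ` with `i : Fin n`). The set of instantaneous controls of player `k` is `P k`; the state
space is `ℝ^d`. The dynamics is `x' = f(t, x, u₀, u₁, …, uₙ)` on `[0, T]`, `x(0) = x₀`, and player
`k` maximizes `σ k (x(T)) + ∫₀ᵀ g k (t, x, u₀, u₁, …, uₙ) dt`. -/
structure DifferentialGame (n d : ℕ) (P : Fin (n + 1) → Type*) where
  /-- terminal time -/
  T : ℝ
  T_nonneg : 0 ≤ T
  /-- initial state -/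
  x₀ : EuclideanSpace ℝ (Fin d)
  /-- right-hand side of the dynamics -/
  f : ℝ → EuclideanSpace ℝ (Fin d) → P 0 → (∀ i : Fin n, P i.succ) → EuclideanSpace ℝ (Fin d)
  /-- running payoffs -/
  g : Fin (n + 1) → ℝ → EuclideanSpace ℝ (Fin d) → P 0 → (∀ i : Fin n, P i.succ) → ℝ
  /-- terminal payoffs -/
  σ : Fin (n + 1) → EuclideanSpace ℝ (Fin d) → ℝ

namespace DifferentialGame

variable {n d : ℕ} {P : Fin (n + 1) → Type*} [∀ k, MeasurableSpace (P k)]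
  (G : DifferentialGame n d P)

/-- Open-loop controls of the leader. -/
abbrev LeaderControl : Type _ := OpenLoop G.T (P 0)

/-- Profiles of open-loop controls of the followers. -/
abbrev Profile : Type _ := ∀ i : Fin n, OpenLoop G.T (P i.succ)

/-- The value at time `s ∈ [0, T]` of the leader's control (clamped outside `[0, T]`, where it is
never used). -/
def leaderAt (u₀ : G.LeaderControl) (s : ℝ) : P 0 := IccExtend G.T_nonneg u₀.1 s

/-- The values at time `s ∈ [0, T]` of the followers' controls (clamped outside `[0, T]`, where
they are never used). -/
def profileAt (u : G.Profile) (s : ℝ) : ∀ i : Fin n, P i.succ :=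
  fun i => IccExtend G.T_nonneg (u i).1 s

/-- `x` is a (Carathéodory) solution on `[t₀, T]` of
`x'(t) = f(t, x(t), u₀(t), u₁(t), …, uₙ(t))`, `x(t₀) = ξ`. -/
def IsMotion (t₀ : ℝ) (ξ : EuclideanSpace ℝ (Fin d)) (u₀ : G.LeaderControl) (u : G.Profile)
    (x : ℝ → EuclideanSpace ℝ (Fin d)) : Prop :=
  IntervalIntegrable (fun s => G.f s (x s) (G.leaderAt u₀ s) (G.profileAt u s)) volume t₀ G.T ∧
    ∀ t ∈ Icc t₀ G.T,
      x t = ξ + ∫ s in t₀..t, G.f s (x s) (G.leaderAt u₀ s) (G.profileAt u s)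

/-- From every position, every tuple of controls generates one and only one motion. -/
def UniquelySolvable : Prop :=
  ∀ t₀ ∈ Icc 0 G.T, ∀ (ξ : EuclideanSpace ℝ (Fin d)) (u₀ : G.LeaderControl) (u : G.Profile),
    (∃ x, G.IsMotion t₀ ξ u₀ u x) ∧
      ∀ x y, G.IsMotion t₀ ξ u₀ u x → G.IsMotion t₀ ξ u₀ u y → EqOn x y (Icc t₀ G.T)

/-- The motion `x(·, t₀, ξ, u₀, u)`. -/
def motion (t₀ : ℝ) (ξ : EuclideanSpace ℝ (Fin d)) (u₀ : G.LeaderControl) (u : G.Profile) :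
    ℝ → EuclideanSpace ℝ (Fin d) :=
  Classical.epsilon (G.IsMotion t₀ ξ u₀ u)

/-- The running payoff of player `k` along the motion `x(·, t₀, ξ, u₀, u)`. -/
def runningPayoff (k : Fin (n + 1)) (t₀ : ℝ) (ξ : EuclideanSpace ℝ (Fin d))
    (u₀ : G.LeaderControl) (u : G.Profile) (s : ℝ) : ℝ :=
  G.g k s (G.motion t₀ ξ u₀ u s) (G.leaderAt u₀ s) (G.profileAt u s)

/-- The running payoffs are integrable along every motion. -/
def PayoffsIntegrable : Prop :=
  ∀ (k : Fin (n + 1)), ∀ t₀ ∈ Icc 0 G.T, ∀ (ξ : EuclideanSpace ℝ (Fin d))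
    (u₀ : G.LeaderControl) (u : G.Profile),
    IntervalIntegrable (G.runningPayoff k t₀ ξ u₀ u) volume t₀ G.T

/-- The payoff-to-go `J k (t₀, ξ, u₀, u)` of player `k` from the position `(t₀, ξ)`. -/
def J (k : Fin (n + 1)) (t₀ : ℝ) (ξ : EuclideanSpace ℝ (Fin d)) (u₀ : G.LeaderControl)
    (u : G.Profile) : ℝ :=
  G.σ k (G.motion t₀ ξ u₀ u G.T) + ∫ s in t₀..G.T, G.runningPayoff k t₀ ξ u₀ u s

/-- `α[u](τ) = α[u'](τ)` whenever the profiles `u` and `u'` coincide on `[0, τ]`. -/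
def Nonanticipative (α : G.Profile → G.LeaderControl) : Prop :=
  ∀ (u u' : G.Profile) (τ : Icc (0 : ℝ) G.T),
    (∀ s ≤ τ, ∀ i, (u i).1 s = (u' i).1 s) → (α u).1 τ = (α u').1 τ

/-- Nonanticipative (incentive) strategies of the leader. -/
def Strategy : Type _ := {α : G.Profile → G.LeaderControl // G.Nonanticipative α}

/-- The set `ℰ_d(α)` of Nash equilibria of the followers against the leader's strategy `α`. -/
def nashEquilibria (α : G.Strategy) : Set G.Profile :=
  {u | ∀ (i : Fin n) (v : OpenLoop G.T (P i.succ)),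
    G.J i.succ 0 G.x₀ (α.1 (Function.update u i v)) (Function.update u i v) ≤
      G.J i.succ 0 G.x₀ (α.1 u) u}

/-- `(α, u)` is an inverse Stackelberg solution. -/
def IsInverseStackelberg (α : G.Strategy) (u : G.Profile) : Prop :=
  u ∈ G.nashEquilibria α ∧
    ∀ β : G.Strategy, ∀ w ∈ G.nashEquilibria β,
      G.J 0 0 G.x₀ (β.1 w) w ≤ G.J 0 0 G.x₀ (α.1 u) u

/-- What the strategy `α` guarantees against follower `i` from `(t₀, ξ)`: the supremum of
follower `i`'s payoff when the other followers keep their controls from `u`. (The component `u i`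
is overwritten, so that only `u₋ᵢ` matters.) -/
def guaranteed (i : Fin n) (t₀ : ℝ) (ξ : EuclideanSpace ℝ (Fin d)) (u : G.Profile)
    (α : G.Strategy) : EReal :=
  ⨆ v : OpenLoop G.T (P i.succ),
    ((G.J i.succ t₀ ξ (α.1 (Function.update u i v)) (Function.update u i v) : ℝ) : EReal)

/-- The lower value `Vᵢ⁻(t₀, ξ, u₋ᵢ)` of the zero-sum game of the leader, who minimizes over
nonanticipative strategies, and follower `i`, who maximizes over open-loop controls. -/
def lowerValue (i : Fin n) (t₀ : ℝ) (ξ : EuclideanSpace ℝ (Fin d)) (u : G.Profile) : EReal :=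
  ⨅ α : G.Strategy, G.guaranteed i t₀ ξ u α

/-- The minimum over the leader's strategies in the definition of the lower value exists. -/
def LowerValuesAttained : Prop :=
  ∀ (i : Fin n), ∀ t₀ ∈ Icc 0 G.T, ∀ (ξ : EuclideanSpace ℝ (Fin d)) (u : G.Profile),
    ∃ α : G.Strategy, G.guaranteed i t₀ ξ u α = G.lowerValue i t₀ ξ u

/-- The set `𝒞`: along the motion generated by `(u₀, u)` from the initial position, the
payoff-to-go of every follower is at every time at least the lower value. -/
def C : Set (G.LeaderControl × G.Profile) :=
  {p | ∀ (i : Fin n), ∀ t ∈ Icc 0 G.T,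
    G.lowerValue i t (G.motion 0 G.x₀ p.1 p.2 t) p.2 ≤
      ((G.J i.succ t (G.motion 0 G.x₀ p.1 p.2 t) p.1 p.2 : ℝ) : EReal)}

/-- `(u₀, u)` maximizes the leader's payoff over `𝒞`. -/
def MaximizesOnC (u₀ : G.LeaderControl) (u : G.Profile) : Prop :=
  (u₀, u) ∈ G.C ∧ ∀ p ∈ G.C, G.J 0 0 G.x₀ p.1 p.2 ≤ G.J 0 0 G.x₀ u₀ u

end DifferentialGame

end

/-! Both parts reduce to one fact: 𝒞 consists exactly of the pairs `(α.1 u, u)` with `u` an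
equilibrium against some nonanticipative `α`. Maximizing the leader's payoff over such pairs is then
the same as maximizing it over 𝒞.

An equilibrium gives a point of 𝒞 (`mem_C_of_mem_nashEquilibria`): a follower who stood below his
lower value at time `t` could keep his control up to `t` and then switch profitably, since `α`, fed
with the past of `u`, is one of the strategies competing in that lower value.

Conversely (`exists_strategy_of_mem_C`), the leader plays `u₀` until a first deviation from `u` and
then plays a strategy attaining the deviator's lower value at the current position. Membership in 𝒞
says that no deviation pays.

Both directions compare payoffs of controls with a common past, which by the flow property amounts
to comparing payoffs-to-go. -/

/-- The control that coincides with `a` up to the time `t` and with `b` afterwards. -/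
noncomputable def OpenLoop.splice {T : ℝ} {Q : Type*} [MeasurableSpace Q] (t : ℝ) (a b : OpenLoop T Q) :
    OpenLoop T Q :=
  ⟨fun s => if (s : ℝ) ≤ t then a.1 s else b.1 s,
    Measurable.ite (measurableSet_le measurable_subtype_coe measurable_const) a.2 b.2⟩

namespace OpenLoop

variable {T : ℝ} {Q : Type*} [MeasurableSpace Q]

theorem splice_of_le {t : ℝ} (a b : OpenLoop T Q) {s : Icc (0 : ℝ) T} (h : (s : ℝ) ≤ t) :
    (splice t a b).1 s = a.1 s :=
  if_pos h

theorem splice_of_lt {t : ℝ} (a b : OpenLoop T Q) {s : Icc (0 : ℝ) T} (h : t < s) :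
    (splice t a b).1 s = b.1 s :=
  if_neg (not_le.2 h)

theorem splice_self (t : ℝ) (a : OpenLoop T Q) : splice t a a = a :=
  Subtype.ext (funext fun _ => ite_self _)

end OpenLoop

namespace DifferentialGame

variable {n d : ℕ} {P : Fin (n + 1) → Type*} [∀ k, MeasurableSpace (P k)]
  {G : DifferentialGame n d P}

/-- The control tuples `(u₀, u)` and `(w₀, w)` coincide at the times of `[0, T]` lying in `s`. -/
def AgreeOn (G : DifferentialGame n d P) (s : Set ℝ) (u₀ : G.LeaderControl) (u : G.Profile)
    (w₀ : G.LeaderControl) (w : G.Profile) : Prop :=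
  ∀ r : Icc (0 : ℝ) G.T, (r : ℝ) ∈ s → u₀.1 r = w₀.1 r ∧ ∀ i, (u i).1 r = (w i).1 r

/-! ### Controls coinciding on an interval -/

section Agreement

variable {s : Set ℝ} {u₀ w₀ : G.LeaderControl} {u w : G.Profile}

theorem AgreeOn.leaderAt_eq (h : G.AgreeOn s u₀ u w₀ w) {r : ℝ} (hr : r ∈ Icc 0 G.T)
    (hs : r ∈ s) : G.leaderAt u₀ r = G.leaderAt w₀ r := by
  rw [leaderAt, leaderAt, IccExtend_of_mem _ _ hr, IccExtend_of_mem _ _ hr]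
  exact (h ⟨r, hr⟩ hs).1

theorem AgreeOn.profileAt_eq (h : G.AgreeOn s u₀ u w₀ w) {r : ℝ} (hr : r ∈ Icc 0 G.T)
    (hs : r ∈ s) : G.profileAt u r = G.profileAt w r := by
  funext i
  rw [profileAt, profileAt, IccExtend_of_mem _ _ hr, IccExtend_of_mem _ _ hr]
  exact (h ⟨r, hr⟩ hs).2 i

/-- Two fields evaluated along motions and controls that coincide on an open interval. -/
theorem AgreeOn.eqOn_field {E : Type*} {a b : ℝ} (ha : 0 ≤ a) (hb : b ≤ G.T)
    (h : G.AgreeOn (Ioo a b) u₀ u w₀ w) {x y : ℝ → EuclideanSpace ℝ (Fin d)}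
    (hxy : EqOn x y (Ioo a b))
    (φ : ℝ → EuclideanSpace ℝ (Fin d) → P 0 → (∀ i : Fin n, P i.succ) → E) :
    EqOn (fun r => φ r (x r) (G.leaderAt u₀ r) (G.profileAt u r))
      (fun r => φ r (y r) (G.leaderAt w₀ r) (G.profileAt w r)) (Ioo a b) := by
  intro r hr
  have hr' : r ∈ Icc 0 G.T := ⟨ha.trans hr.1.le, hr.2.le.trans hb⟩
  simp only [hxy hr, h.leaderAt_eq hr' hr, h.profileAt_eq hr' hr]

end Agreement

/-! ### Locality, concatenation and flow property of motions -/

section Motion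

variable {t₀ t : ℝ} {ξ : EuclideanSpace ℝ (Fin d)} {u₀ w₀ : G.LeaderControl} {u w : G.Profile}

theorem UniquelySolvable.isMotion (hsol : G.UniquelySolvable) (ht₀ : t₀ ∈ Icc 0 G.T)
    (ξ : EuclideanSpace ℝ (Fin d)) (u₀ : G.LeaderControl) (u : G.Profile) :
    G.IsMotion t₀ ξ u₀ u (G.motion t₀ ξ u₀ u) :=
  Classical.epsilon_spec (hsol t₀ ht₀ ξ u₀ u).1

theorem UniquelySolvable.eqOn_motion (hsol : G.UniquelySolvable) (ht₀ : t₀ ∈ Icc 0 G.T)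
    {x : ℝ → EuclideanSpace ℝ (Fin d)} (hx : G.IsMotion t₀ ξ u₀ u x) :
    EqOn x (G.motion t₀ ξ u₀ u) (Icc t₀ G.T) :=
  (hsol t₀ ht₀ ξ u₀ u).2 _ _ hx (hsol.isMotion ht₀ ξ u₀ u)

/-- The integral ignores endpoints, so the open interval suffices; hence the value of a spliced
control at the switching time is immaterial. -/
theorem IsMotion.congr (ht₀ : t₀ ∈ Icc 0 G.T) (h : G.AgreeOn (Ioo t₀ G.T) u₀ u w₀ w)
    {x : ℝ → EuclideanSpace ℝ (Fin d)} (hx : G.IsMotion t₀ ξ u₀ u x) :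
    G.IsMotion t₀ ξ w₀ w x := by
  have he := h.eqOn_field ht₀.1 le_rfl (eqOn_refl x _) G.f
  refine ⟨hx.1.congr_uIoo (by rwa [uIoo_of_le ht₀.2]), fun t ht => ?_⟩
  rw [hx.2 t ht, intervalIntegral.integral_congr_Ioo_of_le ht.1
    (he.mono (Ioo_subset_Ioo_right ht.2))]

/-- Concatenation of motions at the time `t`. -/
theorem IsMotion.concat (ht₀ : t₀ ∈ Icc 0 G.T) (ht : t ∈ Icc t₀ G.T)
    (h : G.AgreeOn (Ioo t₀ t) w₀ w u₀ u) {x z : ℝ → EuclideanSpace ℝ (Fin d)}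
    (hx : G.IsMotion t₀ ξ w₀ w x) (hz : G.IsMotion t (x t) u₀ u z) :
    G.IsMotion t₀ ξ u₀ u (fun s => if s ≤ t then x s else z s) := by
  set y : ℝ → EuclideanSpace ℝ (Fin d) := fun s => if s ≤ t then x s else z s with hy
  have hxy : EqOn x y (Ioo t₀ t) := fun s hs => by simp only [hy, if_pos hs.2.le]
  have hzy : EqOn z y (Ioo t G.T) := fun s hs => by simp only [hy, if_neg (not_le.2 hs.1)]
  have e₁ := h.eqOn_field ht₀.1 ht.2 hxy G.f
  have e₂ := AgreeOn.eqOn_field (G := G) (u₀ := u₀) (u := u) (w₀ := u₀) (w := u)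
    (ht₀.1.trans ht.1) le_rfl (fun _ _ => ⟨rfl, fun _ => rfl⟩) hzy G.f
  have i₁ : IntervalIntegrable (fun s => G.f s (y s) (G.leaderAt u₀ s) (G.profileAt u s))
      volume t₀ t := by
    refine IntervalIntegrable.congr_uIoo (hx.1.mono_set ?_) (by rwa [uIoo_of_le ht.1])
    rw [uIcc_of_le ht.1, uIcc_of_le ht₀.2]
    exact Icc_subset_Icc_right ht.2
  have i₂ : IntervalIntegrable (fun s => G.f s (y s) (G.leaderAt u₀ s) (G.profileAt u s))
      volume t G.T := hz.1.congr_uIoo (by rwa [uIoo_of_le ht.2])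
  refine ⟨i₁.trans i₂, fun s hs => ?_⟩
  rcases le_or_gt s t with hst | hst
  · rw [hy]
    simp only [if_pos hst]
    rw [hx.2 s hs, intervalIntegral.integral_congr_Ioo_of_le hs.1
      (e₁.mono (Ioo_subset_Ioo_right hst))]
  · have hi : IntervalIntegrable (fun s => G.f s (y s) (G.leaderAt u₀ s) (G.profileAt u s))
        volume t s := by
      refine i₂.mono_set ?_
      rw [uIcc_of_le hst.le, uIcc_of_le ht.2]
      exact Icc_subset_Icc_right hs.2
    have : y s = z s := by simp only [hy, if_neg (not_le.2 hst)]
    rw [this, hz.2 s ⟨hst.le, hs.2⟩, hx.2 t ht, ← intervalIntegral.integral_add_adjacent_intervals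
      i₁ hi, intervalIntegral.integral_congr_Ioo_of_le ht.1 e₁,
      intervalIntegral.integral_congr_Ioo_of_le hst.le (e₂.mono (Ioo_subset_Ioo_right hs.2)),
      add_assoc]

/-- Motions generated by controls that coincide up to the time `t` coincide up to `t`. -/
theorem UniquelySolvable.motion_eqOn_of_agreeOn (hsol : G.UniquelySolvable)
    (ht₀ : t₀ ∈ Icc 0 G.T) (ht : t ∈ Icc t₀ G.T) (h : G.AgreeOn (Ioo t₀ t) w₀ w u₀ u) :
    EqOn (G.motion t₀ ξ w₀ w) (G.motion t₀ ξ u₀ u) (Icc t₀ t) := by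
  intro s hs
  -- Follow the first motion up to `t`, then the controls `u₀`, `u`: this is a motion for `u₀`, `u`
  -- throughout, so uniqueness identifies it.
  have hm := (hsol.isMotion ht₀ ξ w₀ w).concat ht₀ ht h
    (hsol.isMotion ⟨ht₀.1.trans ht.1, ht.2⟩ _ u₀ u)
  simpa [hs.2] using hsol.eqOn_motion ht₀ hm ⟨hs.1, hs.2.trans ht.2⟩

/-- The flow property of motions. -/
theorem UniquelySolvable.motion_flow (hsol : G.UniquelySolvable)
    (ht₀ : t₀ ∈ Icc 0 G.T) (ht : t ∈ Icc t₀ G.T) :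
    EqOn (G.motion t (G.motion t₀ ξ u₀ u t) u₀ u) (G.motion t₀ ξ u₀ u) (Icc t G.T) := by
  intro s hs
  have ht' : t ∈ Icc 0 G.T := ⟨ht₀.1.trans ht.1, ht.2⟩
  have hm := (hsol.isMotion ht₀ ξ u₀ u).concat (t := t) ht₀ ht (fun _ _ => ⟨rfl, fun _ => rfl⟩)
    (hsol.isMotion ht' _ u₀ u)
  rcases hs.1.eq_or_lt with rfl | hlt
  · have := (hsol.isMotion ht' (G.motion t₀ ξ u₀ u t) u₀ u).2 t ⟨le_rfl, ht.2⟩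
    simpa using this
  · simpa [not_le.2 hlt] using hsol.eqOn_motion ht₀ hm ⟨ht.1.trans hs.1, hs.2⟩

end Motion

/-! ### Payoffs and payoffs-to-go -/

section Payoff

variable {t : ℝ} {u₀ w₀ : G.LeaderControl} {u w : G.Profile}

/-- The payoff-to-go depends only on the future of the controls. -/
theorem UniquelySolvable.J_congr (hsol : G.UniquelySolvable) (k : Fin (n + 1))
    (ht : t ∈ Icc 0 G.T) (ξ : EuclideanSpace ℝ (Fin d))
    (h : G.AgreeOn (Ioo t G.T) u₀ u w₀ w) : G.J k t ξ u₀ u = G.J k t ξ w₀ w := by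
  have hm : EqOn (G.motion t ξ u₀ u) (G.motion t ξ w₀ w) (Icc t G.T) :=
    hsol.eqOn_motion ht ((hsol.isMotion ht ξ u₀ u).congr ht h)
  rw [J, J, hm ⟨ht.2, le_rfl⟩]
  congr 1
  exact intervalIntegral.integral_congr_Ioo_of_le ht.2
    (h.eqOn_field ht.1 le_rfl (hm.mono Ioo_subset_Icc_self) (G.g k))

/-- The payoff accumulated up to the time `t` and the payoff-to-go from `t`. -/
theorem J_eq_integral_add_J (hsol : G.UniquelySolvable) (hint : G.PayoffsIntegrable)
    (k : Fin (n + 1)) (ht : t ∈ Icc 0 G.T) (ξ : EuclideanSpace ℝ (Fin d))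
    (u₀ : G.LeaderControl) (u : G.Profile) :
    G.J k 0 ξ u₀ u =
      (∫ s in 0..t, G.runningPayoff k 0 ξ u₀ u s) + G.J k t (G.motion 0 ξ u₀ u t) u₀ u := by
  have h0 : (0 : ℝ) ∈ Icc 0 G.T := ⟨le_rfl, G.T_nonneg⟩
  have hm := hsol.motion_flow (ξ := ξ) (u₀ := u₀) (u := u) h0 ht
  have hI := hint k 0 h0 ξ u₀ u
  have i₁ : IntervalIntegrable (G.runningPayoff k 0 ξ u₀ u) volume 0 t := by
    refine hI.mono_set ?_
    rw [uIcc_of_le ht.1, uIcc_of_le h0.2]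
    exact Icc_subset_Icc_right ht.2
  have i₂ : IntervalIntegrable (G.runningPayoff k 0 ξ u₀ u) volume t G.T := by
    refine hI.mono_set ?_
    rw [uIcc_of_le ht.2, uIcc_of_le h0.2]
    exact Icc_subset_Icc_left ht.1
  have e : ∫ s in t..G.T, G.runningPayoff k t (G.motion 0 ξ u₀ u t) u₀ u s =
      ∫ s in t..G.T, G.runningPayoff k 0 ξ u₀ u s :=
    intervalIntegral.integral_congr_Ioo_of_le ht.2
      (AgreeOn.eqOn_field (G := G) (u₀ := u₀) (u := u) ht.1 le_rfl
        (fun _ _ => ⟨rfl, fun _ => rfl⟩) (hm.mono Ioo_subset_Icc_self) (G.g k))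
  rw [J, J, hm ⟨ht.2, le_rfl⟩, e, ← intervalIntegral.integral_add_adjacent_intervals i₁ i₂]
  ring

/-- For controls that coincide up to the time `t`, payoffs compare as payoffs-to-go from `t`. -/
theorem J_le_J_iff_of_agreeOn (hsol : G.UniquelySolvable) (hint : G.PayoffsIntegrable)
    (k : Fin (n + 1)) (ht : t ∈ Icc 0 G.T) (ξ : EuclideanSpace ℝ (Fin d))
    (h : G.AgreeOn (Ioo 0 t) w₀ w u₀ u) :
    G.J k 0 ξ w₀ w ≤ G.J k 0 ξ u₀ u ↔
      G.J k t (G.motion 0 ξ u₀ u t) w₀ w ≤ G.J k t (G.motion 0 ξ u₀ u t) u₀ u := by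
  have hm : EqOn (G.motion 0 ξ w₀ w) (G.motion 0 ξ u₀ u) (Icc 0 t) :=
    hsol.motion_eqOn_of_agreeOn ⟨le_rfl, G.T_nonneg⟩ ht h
  have e : ∫ s in 0..t, G.runningPayoff k 0 ξ w₀ w s = ∫ s in 0..t, G.runningPayoff k 0 ξ u₀ u s :=
    intervalIntegral.integral_congr_Ioo_of_le ht.1
      (h.eqOn_field le_rfl ht.2 (hm.mono Ioo_subset_Icc_self) (G.g k))
  rw [J_eq_integral_add_J hsol hint k ht ξ w₀ w, J_eq_integral_add_J hsol hint k ht ξ u₀ u, e,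
    hm ⟨ht.1, le_rfl⟩, add_le_add_iff_left]

end Payoff

/-! ### Equilibria lie in 𝒞 -/

section Necessity

/-- The strategy that reacts to a profile as if it had been `u` up to the time `t`. -/
noncomputable def Strategy.rewind (α : G.Strategy) (t : ℝ) (u : G.Profile) : G.Strategy :=
  ⟨fun w => α.1 fun j => OpenLoop.splice t (u j) (w j), fun w w' τ h => by
    refine α.2 _ _ τ fun s hs i => ?_
    change (if (s : ℝ) ≤ t then (u i).1 s else (w i).1 s) =
      if (s : ℝ) ≤ t then (u i).1 s else (w' i).1 s
    rw [h s hs i]⟩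

theorem mem_C_of_mem_nashEquilibria (hsol : G.UniquelySolvable) (hint : G.PayoffsIntegrable)
    {α : G.Strategy} {u : G.Profile} (hu : u ∈ G.nashEquilibria α) : (α.1 u, u) ∈ G.C := by
  intro i t ht
  -- The rewound strategy bounds the lower value from above, so each reply `v` to it has to earn at
  -- most the payoff-to-go of `u`.
  refine (iInf_le _ (α.rewind t u)).trans (iSup_le fun v => EReal.coe_le_coe_iff.2 ?_)
  have hs : (fun j => OpenLoop.splice t (u j) (Function.update u i v j)) =
      Function.update u i (OpenLoop.splice t (u i) v) := by
    funext j
    rcases eq_or_ne j i with rfl | hj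
    · simp
    · simp [hj, OpenLoop.splice_self]
  have hα : (α.rewind t u).1 (Function.update u i v) =
      α.1 (Function.update u i (OpenLoop.splice t (u i) v)) := congrArg α.1 hs
  -- From `t` on, `v` may be replaced by the deviation that follows `u i` up to `t`; the equilibrium
  -- condition applies to that one.
  rw [hα, hsol.J_congr (w₀ := α.1 (Function.update u i (OpenLoop.splice t (u i) v)))
    (w := Function.update u i (OpenLoop.splice t (u i) v)) i.succ ht]
  · refine (J_le_J_iff_of_agreeOn hsol hint i.succ ht G.x₀ fun r hr => ?_).1 (hu i _)
    have key : ∀ s : Icc (0 : ℝ) G.T, s ≤ r → ∀ j,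
        (Function.update u i (OpenLoop.splice t (u i) v) j).1 s = (u j).1 s := by
      intro s hsr j
      rw [← congrFun hs j]
      exact OpenLoop.splice_of_le _ _ ((Subtype.coe_le_coe.2 hsr).trans hr.2.le)
    exact ⟨α.2 _ _ r key, key r le_rfl⟩
  · refine fun r hr => ⟨rfl, fun j => ?_⟩
    rw [← congrFun hs j]
    exact (OpenLoop.splice_of_lt _ _ hr.1).symm

end Necessity

/-! ### Trigger strategies realize 𝒞 -/

section Sufficiency

/-- The times at which follower `i`'s control in `w` differs from his control in `u`. -/
def deviationTimes (u w : G.Profile) (i : Fin n) : Set ℝ :=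
  {s | ∃ h : s ∈ Icc 0 G.T, (w i).1 ⟨s, h⟩ ≠ (u i).1 ⟨s, h⟩}

/-- The first time at which `w` deviates from `u`; it is `T` if there is no deviation. -/
noncomputable def firstDeviation (u w : G.Profile) : ℝ :=
  sInf (insert G.T (⋃ i, deviationTimes u w i))

/-- The followers who deviate from `u` at or immediately after the first deviation time. -/
def firstDeviators (u w : G.Profile) : Set (Fin n) :=
  {i | ∀ s > firstDeviation u w, ∃ r ∈ deviationTimes u w i, r < s}

variable {u w w' : G.Profile}

theorem deviationTimes_union_subset (u w : G.Profile) :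
    insert G.T (⋃ i, deviationTimes u w i) ⊆ Icc 0 G.T := by
  refine insert_subset ⟨G.T_nonneg, le_rfl⟩ (iUnion_subset fun i s hs => hs.1)

theorem firstDeviation_mem (u w : G.Profile) : firstDeviation u w ∈ Icc 0 G.T :=
  ⟨le_csInf (insert_nonempty _ _) fun _ hs => (deviationTimes_union_subset u w hs).1,
    csInf_le ⟨0, fun _ hs => (deviationTimes_union_subset u w hs).1⟩ (mem_insert _ _)⟩

theorem firstDeviation_le {i : Fin n} {s : ℝ} (hs : s ∈ deviationTimes u w i) :
    firstDeviation u w ≤ s :=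
  csInf_le ⟨0, fun _ hs => (deviationTimes_union_subset u w hs).1⟩
    (mem_insert_of_mem _ (mem_iUnion.2 ⟨i, hs⟩))

theorem eq_of_lt_firstDeviation {s : Icc (0 : ℝ) G.T} (hs : (s : ℝ) < firstDeviation u w)
    (i : Fin n) : (w i).1 s = (u i).1 s := by
  by_contra hne
  exact absurd (firstDeviation_le (i := i) ⟨s.2, hne⟩) (not_le.2 hs)

theorem exists_deviation_lt {s : ℝ} (hs : firstDeviation u w < s) (hsT : s ≤ G.T) :
    ∃ i, ∃ r ∈ deviationTimes u w i, r < s := by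
  obtain ⟨r, hr, hrs⟩ := exists_lt_of_csInf_lt (insert_nonempty _ _) hs
  rcases hr with rfl | hr
  · exact absurd hrs (not_lt.2 hsT)
  · obtain ⟨i, hi⟩ := mem_iUnion.1 hr
    exact ⟨i, r, hi, hrs⟩

theorem mem_deviationTimes_congr {τ : Icc (0 : ℝ) G.T} (h : ∀ s ≤ τ, ∀ i, (w i).1 s = (w' i).1 s)
    {i : Fin n} {r : ℝ} (hr : r ≤ τ) (hd : r ∈ deviationTimes u w i) :
    r ∈ deviationTimes u w' i := by
  obtain ⟨h₁, h₂⟩ := hd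
  exact ⟨h₁, h ⟨r, h₁⟩ hr i ▸ h₂⟩

/-- The infimum need not be attained, but if it is below `τ` then deviations arbitrarily close to it
occur before `τ`, where `w` and `w'` agree. The strict inequality is what makes the first deviation
observable by time `τ`. -/
theorem firstDeviation_le_of_agree {τ : Icc (0 : ℝ) G.T}
    (h : ∀ s ≤ τ, ∀ i, (w i).1 s = (w' i).1 s) (hτ : firstDeviation u w < τ) :
    firstDeviation u w' ≤ firstDeviation u w := by
  refine le_of_forall_gt_imp_ge_of_dense fun s hs => ?_
  obtain ⟨i, r, hr, hrs⟩ := exists_deviation_lt (lt_min hs hτ) ((min_le_right _ _).trans τ.2.2)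
  exact (firstDeviation_le (mem_deviationTimes_congr h (hrs.le.trans (min_le_right _ _)) hr)).trans
    (hrs.le.trans (min_le_left _ _))

theorem firstDeviation_eq_of_agree {τ : Icc (0 : ℝ) G.T}
    (h : ∀ s ≤ τ, ∀ i, (w i).1 s = (w' i).1 s) (hτ : firstDeviation u w < τ) :
    firstDeviation u w' = firstDeviation u w := by
  have h₁ := firstDeviation_le_of_agree h hτ
  exact le_antisymm h₁
    (firstDeviation_le_of_agree (fun s hs i => (h s hs i).symm) (h₁.trans_lt hτ))

theorem firstDeviators_subset_of_agree {τ : Icc (0 : ℝ) G.T}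
    (h : ∀ s ≤ τ, ∀ i, (w i).1 s = (w' i).1 s) (hτ : firstDeviation u w < τ) :
    firstDeviators u w ⊆ firstDeviators u w' := by
  intro i hi s hs
  rw [firstDeviation_eq_of_agree h hτ] at hs
  obtain ⟨r, hr, hrs⟩ := hi _ (lt_min hs hτ)
  exact ⟨r, mem_deviationTimes_congr h (hrs.le.trans (min_le_right _ _)) hr,
    hrs.trans_le (min_le_left _ _)⟩

theorem firstDeviators_eq_of_agree {τ : Icc (0 : ℝ) G.T}
    (h : ∀ s ≤ τ, ∀ i, (w i).1 s = (w' i).1 s) (hτ : firstDeviation u w < τ) :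
    firstDeviators u w' = firstDeviators u w :=
  (firstDeviators_subset_of_agree (fun s hs i => (h s hs i).symm)
    (firstDeviation_eq_of_agree h hτ ▸ hτ)).antisymm (firstDeviators_subset_of_agree h hτ)

theorem firstDeviation_self (u : G.Profile) : firstDeviation u u = G.T := by
  have : ∀ i, deviationTimes u u i = ∅ := fun i => eq_empty_of_forall_notMem fun s hs => hs.2 rfl
  simp [firstDeviation, this]

theorem firstDeviators_update {i : Fin n} {v : OpenLoop G.T (P i.succ)}
    (h : firstDeviation u (Function.update u i v) < G.T) :
    firstDeviators u (Function.update u i v) = {i} := by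
  have hempty : ∀ j ≠ i, ∀ r, r ∉ deviationTimes u (Function.update u i v) j := by
    rintro j hj r ⟨h₁, h₂⟩
    rw [Function.update_of_ne hj] at h₂
    exact h₂ rfl
  ext j
  rw [mem_singleton_iff]
  refine ⟨fun hj => ?_, ?_⟩
  · by_contra hne
    obtain ⟨r, hr, -⟩ := hj _ h
    exact hempty j hne r hr
  · rintro rfl s hs
    obtain ⟨k, r, hr, hrs⟩ := exists_deviation_lt (lt_min hs h) (min_le_right _ _)
    obtain rfl : k = j := by
      by_contra hne
      exact hempty k hne r hr
    exact ⟨r, hr, hrs.trans_le (min_le_left _ _)⟩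

/-- The strategy that ignores the followers' controls. -/
def Strategy.const (u₀ : G.LeaderControl) : G.Strategy :=
  ⟨fun _ => u₀, fun _ _ _ _ => rfl⟩

open Classical in
/-- The reaction `π i t` to some follower `i` in `S`, and the fixed control `u₀` if there is none. -/
noncomputable def punishment (u₀ : G.LeaderControl) (π : Fin n → ℝ → G.Strategy) (t : ℝ) (S : Set (Fin n)) :
    G.Strategy :=
  if h : S.Nonempty then π h.some t else Strategy.const u₀

theorem punishment_singleton (u₀ : G.LeaderControl) (π : Fin n → ℝ → G.Strategy) (t : ℝ)
    (i : Fin n) : punishment u₀ π t {i} = π i t := by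
  rw [punishment, dif_pos (singleton_nonempty i), mem_singleton_iff.1 (singleton_nonempty i).some_mem]

/-- The strategy that plays `u₀` until the followers deviate from `u` and then punishes one of the
first deviators. -/
noncomputable def triggerStrategy (u₀ : G.LeaderControl) (u : G.Profile) (π : Fin n → ℝ → G.Strategy) :
    G.Strategy :=
  ⟨fun w => OpenLoop.splice (firstDeviation u w) u₀
      ((punishment u₀ π (firstDeviation u w) (firstDeviators u w)).1 w), fun w w' τ h => by
    rcases le_or_gt (τ : ℝ) (firstDeviation u w) with hτ | hτ
    -- A deviation of `w'` strictly before `τ` would be visible in `w` too.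
    · have hτ' : (τ : ℝ) ≤ firstDeviation u w' := by
        by_contra hlt
        have h' : ∀ s ≤ τ, ∀ i, (w' i).1 s = (w i).1 s := fun s hs i => (h s hs i).symm
        exact hlt (hτ.trans_eq (firstDeviation_eq_of_agree h' (not_le.1 hlt)))
      rw [OpenLoop.splice_of_le _ _ hτ, OpenLoop.splice_of_le _ _ hτ']
    · have e := firstDeviation_eq_of_agree h hτ
      beta_reduce
      rw [e, firstDeviators_eq_of_agree h hτ, OpenLoop.splice_of_lt _ _ hτ,
        OpenLoop.splice_of_lt _ _ hτ]
      exact (punishment _ _ _ _).2 w w' τ h⟩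

theorem triggerStrategy_self (u₀ : G.LeaderControl) (u : G.Profile)
    (π : Fin n → ℝ → G.Strategy) : (triggerStrategy u₀ u π).1 u = u₀ :=
  Subtype.ext (funext fun s =>
    OpenLoop.splice_of_le _ _ (s.2.2.trans_eq (firstDeviation_self u).symm))

/-- A unilateral deviation identifies its author, so the punishment started at time `t` is optimal
against him and holds him to his lower value at `t`, which 𝒞 bounds by his payoff-to-go under `(u₀,
u)`. -/
theorem exists_strategy_of_mem_C (hsol : G.UniquelySolvable) (hint : G.PayoffsIntegrable)
    (hval : G.LowerValuesAttained) {u₀ : G.LeaderControl} {u : G.Profile}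
    (hC : (u₀, u) ∈ G.C) : ∃ α : G.Strategy, α.1 u = u₀ ∧ u ∈ G.nashEquilibria α := by
  have hπ : ∀ (i : Fin n) (t : ℝ), ∃ α : G.Strategy, t ∈ Icc 0 G.T →
      G.guaranteed i t (G.motion 0 G.x₀ u₀ u t) u α =
        G.lowerValue i t (G.motion 0 G.x₀ u₀ u t) u := by
    intro i t
    by_cases ht : t ∈ Icc 0 G.T
    · obtain ⟨α, hα⟩ := hval i t ht (G.motion 0 G.x₀ u₀ u t) u
      exact ⟨α, fun _ => hα⟩
    · exact ⟨Strategy.const u₀, fun h => absurd h ht⟩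
  choose π hπ using hπ
  refine ⟨triggerStrategy u₀ u π, triggerStrategy_self u₀ u π, fun i v => ?_⟩
  rw [triggerStrategy_self]
  set w := Function.update u i v with hw
  set t := firstDeviation u w with ht_def
  have ht : t ∈ Icc 0 G.T := firstDeviation_mem u w
  refine (J_le_J_iff_of_agreeOn hsol hint i.succ ht G.x₀ fun r hr => ?_).2 ?_
  · exact ⟨OpenLoop.splice_of_le _ _ hr.2.le, eq_of_lt_firstDeviation hr.2⟩
  -- If `t = T`, any deviation is confined to the single time `T` and changes no payoff.
  rcases ht.2.eq_or_lt with htT | htT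
  · refine (hsol.J_congr i.succ ht _ fun r hr => ?_).le
    exact absurd (hr.1.trans hr.2) (not_lt.2 htT.ge)
  · have hp : punishment u₀ π t (firstDeviators u w) = π i t := by
      rw [hw, firstDeviators_update htT, punishment_singleton]
    rw [hsol.J_congr (w₀ := (π i t).1 w) (w := w) i.succ ht]
    · refine EReal.coe_le_coe_iff.1 (le_trans ?_ (hC i t ht))
      rw [← hπ i t ht]
      exact le_iSup (fun v : OpenLoop G.T (P i.succ) =>
        ((G.J i.succ t (G.motion 0 G.x₀ u₀ u t) ((π i t).1 (Function.update u i v))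
          (Function.update u i v) : ℝ) : EReal)) v
    · refine fun r hr => ⟨?_, fun _ => rfl⟩
      rw [← hp]
      exact OpenLoop.splice_of_lt _ _ hr.1

end Sufficiency

end DifferentialGame

theorem theorem3 {n d : ℕ} {P : Fin (n + 1) → Type*} [∀ k, MeasurableSpace (P k)]
    (G : DifferentialGame n d P)
    (hsol : G.UniquelySolvable) (hint : G.PayoffsIntegrable) (hval : G.LowerValuesAttained) :
    (∀ (α : G.Strategy) (u : G.Profile), G.IsInverseStackelberg α u →
      G.MaximizesOnC (α.1 u) u) ∧
    (∀ (u₀ : G.LeaderControl) (u : G.Profile), G.MaximizesOnC u₀ u →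
      ∃ α : G.Strategy, α.1 u = u₀ ∧ G.IsInverseStackelberg α u) := by
  refine ⟨fun α u h => ⟨DifferentialGame.mem_C_of_mem_nashEquilibria hsol hint h.1, ?_⟩, ?_⟩
  · rintro ⟨w₀, w⟩ hp
    obtain ⟨β, rfl, hβ⟩ := DifferentialGame.exists_strategy_of_mem_C hsol hint hval hp
    exact h.2 β w hβ
  · rintro u₀ u ⟨hC, hmax⟩
    obtain ⟨α, rfl, hα⟩ := DifferentialGame.exists_strategy_of_mem_C hsol hint hval hC
    exact ⟨α, rfl, hα, fun β w hw =>
      hmax _ (DifferentialGame.mem_C_of_mem_nashEquilibria hsol hint hw)⟩
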